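/- Let $d > 2/\sqrt3$. The symmetric hexagon mesh has 13 nodes: node $1$ at the origin; nodes $2,\dots,7$ (the inner ring), node $2+k$ at $\big(\cos\frac{k\pi}{3}, \sin\frac{k\pi}{3}\big)$; and nodes $8,\dots,13$ (the outer ring), node $8+k$ at $\big(d\cos\frac{(2k-1)\pi}{6}, d\sin\frac{(2k-1)\pi}{6}\big)$, for $0\le k\le 5$. With $k$ read modulo $6$, its 18 triangles are those with nodes $\{1,\,2+k,\,2+(k+1)\}$, $\{2+k,\,2+(k+1),\,8+(k+1)\}$ and $\{2+k,\,8+k,\,8+(k+1)\}$, for $0\le k\le5$. The interior nodes are $I=\{1,\dots,7\}$ and the boundary nodes are $B=\{8,\dots,13\}$. For any positions of the 13 nodes (with the same triangles) let $\phi_1,\dots,\phi_{13}$ be the piecewise linear nodal basis functions, and let $A$ and $M$ be the stiffness and mass matrices, with entries $a_{i,j}=\sum_T\int_T\nabla\phi_j\cdot\nabla\phi_i\,dA$ and $m_{i,j}=\sum_T\int_T\phi_j\phi_i\,dA$, the sums being over the triangles $T$ of the mesh. Write $A_{II},A_{BI},M_{II},M_{BI}$ for their blocks. The mesh satisfies the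 unique continuation principle if $$\ker(A_{II}-\lambda M_{II})\cap\ker(A_{BI}-\lambda M_{BI})=\{0\}\quad\text{for all }\lambda\in\mathbb R .$$ For the symmetric hexagon mesh let $$\lambda_*=\frac{a_{2,2}-2a_{2,3}}{m_{2,2}-2m_{2,3}},$$ and suppose that $\lambda_*$ is a simple Neumann eigenvalue of this mesh, that is, $\dim\ker(A-\lambda_*M)=1$. Let $$u_I=(0,1,-1,1,-1,1,-1)\in\mathbb R^7,\qquad \hat u_B=(1,-1,1,-1,1,-1)\in\mathbb R^6 .$$ Let $\boldsymbol x_i(s)$, $1\le i\le13$, be paths in $\mathbb R^2$ that are $C^1$ near $s=0$ and such that $\boldsymbol x_i(0)$ is the $i$-th node of the symmetric hexagon mesh. Let $A(s)$, $M(s)$ be the stiffness and mass matrices of the deformed mesh with nodes $\boldsymbol x_i(s)$ and the same triangles, and let $\dot A$, $\dot M$ be their derivatives at $s=0$. If $$\big\langle(\dot A_{BI}-\lambda_*\dot M_{BI})u_I,\hat u_B\big\rangle\neq0,$$ then there is $\varepsilon>0$ such that the deformed mesh satisfies the unique continuation principle for all $s$ with $0<|s|<\varepsilon$. -/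

import Mathlib

open scoped Matrix

noncomputable section

namespace P1FEM

/-- The Euclidean plane. -/
abbrev Plane : Type := EuclideanSpace ℝ (Fin 2)

/-- The affine nodal basis function attached to the vertex `p a` of the triangle with vertices
`p 0, p 1, p 2`; the other two vertices are `p (a + 1)` and `p (a + 2)` (indices modulo 3). -/
def nodalFunction (p : Fin 3 → Plane) (a : Fin 3) (x : Plane) : ℝ :=
  ((p (a + 1) 0 - x 0) * (p (a + 2) 1 - x 1) - (p (a + 2) 0 - x 0) * (p (a + 1) 1 - x 1)) /
    ((p (a + 1) 0 - p a 0) * (p (a + 2) 1 - p a 1) -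
      (p (a + 2) 0 - p a 0) * (p (a + 1) 1 - p a 1))

section Mesh

/-! A triangular mesh is given by the positions `X : V → Plane` of its nodes and by a finite family
`tri : τ → Fin 3 → V` of triangles, each listed through its three nodes. -/

variable {V τ : Type} [DecidableEq V] [Fintype τ]

/-- The closed triangle with the nodes `T 0, T 1, T 2`. -/
def element (X : V → Plane) (T : Fin 3 → V) : Set Plane :=
  convexHull ℝ (Set.range fun a => X (T a))

/-- The restriction to the triangle `T` of the piecewise linear basis function of the node `v`:
the nodal function of `v` if `v` is a node of `T`, and zero otherwise. -/
def basisOn (X : V → Plane) (T : Fin 3 → V) (v : V) (x : Plane) : ℝ :=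
  ∑ a : Fin 3, if T a = v then nodalFunction (fun b => X (T b)) a x else 0

/-- The stiffness matrix `a i j = ∫ ∇φ_j · ∇φ_i`, integrated over all triangles of the mesh. -/
def stiffness (tri : τ → Fin 3 → V) (X : V → Plane) : Matrix V V ℝ :=
  Matrix.of fun i j => ∑ t : τ, ∫ x in element X (tri t),
    inner ℝ (gradient (basisOn X (tri t) j) x) (gradient (basisOn X (tri t) i) x)

/-- The mass matrix `m i j = ∫ φ_j φ_i`, integrated over all triangles of the mesh. -/
def mass (tri : τ → Fin 3 → V) (X : V → Plane) : Matrix V V ℝ :=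
  Matrix.of fun i j => ∑ t : τ, ∫ x in element X (tri t),
    basisOn X (tri t) j x * basisOn X (tri t) i x

end Mesh

/-- `lam` is a simple eigenvalue of the discrete Neumann problem `A u = lam M u`. -/
def IsSimpleNeumannEigenvalue {V : Type} [Fintype V] (A M : Matrix V V ℝ) (lam : ℝ) : Prop :=
  Module.finrank ℝ (LinearMap.ker (A - lam • M).mulVecLin) = 1

section InnerSolutions

/-! The nodes are `I ⊕ B`, with `I` the interior nodes and `B` the boundary nodes, so that
`toBlocks₁₁` is the `II` block and `toBlocks₂₁` is the `BI` block of a matrix. -/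

variable {I B : Type} [Fintype I] [Fintype B]

/-- The space `ker (A_II - lam M_II) ∩ ker (A_BI - lam M_BI)` of inner solutions. -/
def innerSolutions (A M : Matrix (I ⊕ B) (I ⊕ B) ℝ) (lam : ℝ) : Submodule ℝ (I → ℝ) :=
  LinearMap.ker (A.toBlocks₁₁ - lam • M.toBlocks₁₁).mulVecLin ⊓
    LinearMap.ker (A.toBlocks₂₁ - lam • M.toBlocks₂₁).mulVecLin

/-- The unique continuation principle for the piecewise linear discretization on a mesh. -/
def UniqueContinuation [DecidableEq I] [DecidableEq B] {τ : Type} [Fintype τ]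
    (tri : τ → Fin 3 → I ⊕ B) (X : I ⊕ B → Plane) : Prop :=
  ∀ lam : ℝ, innerSolutions (stiffness tri X) (mass tri X) lam = ⊥

end InnerSolutions

/-- The entrywise derivative at `s = 0` of a family of matrices. -/
def derivAtZero {m n : Type} (F : ℝ → Matrix m n ℝ) : Matrix m n ℝ :=
  Matrix.of fun i j => deriv (fun s => F s i j) 0

/-- The 13 nodes of the hexagon mesh: `inl 0` is the centre (node 1), `inl 1, …, inl 6` are the
inner ring (nodes 2 to 7), and `inr 0, …, inr 5` are the outer ring (nodes 8 to 13), which are the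
boundary nodes. -/
abbrev HexNode : Type := Fin 7 ⊕ Fin 6

/-- The node positions of the symmetric hexagon mesh. The outer ring is numbered so that node
`inr k` lies between the directions of its two interior neighbours `k - 1` and `k` (modulo 6) in the
inner ring; hence the angle `(2 k - 1) π / 6`. -/
def hexPosition (d : ℝ) : HexNode → Plane
  | Sum.inl i => Fin.cases !₂[0, 0]
      (fun k : Fin 6 => !₂[Real.cos ((k : ℕ) * Real.pi / 3), Real.sin ((k : ℕ) * Real.pi / 3)]) i
  | Sum.inr k => !₂[d * Real.cos ((2 * ((k : ℕ) : ℝ) - 1) * Real.pi / 6),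
      d * Real.sin ((2 * ((k : ℕ) : ℝ) - 1) * Real.pi / 6)]

/-- The 18 triangles of the hexagon mesh, in three families of six (indexed by `t.2`, modulo 6): those at
the centre, those with two nodes on the inner ring and one on the outer ring, and those with one
node on the inner ring and two on the outer ring. -/
def hexTriangle (t : Fin 3 × Fin 6) : Fin 3 → HexNode :=
  ![![Sum.inl 0, Sum.inl t.2.succ, Sum.inl (t.2 + 1).succ],
    ![Sum.inl t.2.succ, Sum.inl (t.2 + 1).succ, Sum.inr (t.2 + 1)],
    ![Sum.inl t.2.succ, Sum.inr t.2, Sum.inr (t.2 + 1)]] t.1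

/-- The stiffness matrix of the hexagon mesh with its nodes at the positions `X`. -/
def hexStiffness (X : HexNode → Plane) : Matrix HexNode HexNode ℝ := stiffness hexTriangle X

/-- The mass matrix of the hexagon mesh with its nodes at the positions `X`. -/
def hexMass (X : HexNode → Plane) : Matrix HexNode HexNode ℝ := mass hexTriangle X

/-- `λ_* = (a₂₂ - 2 a₂₃) / (m₂₂ - 2 m₂₃)` for the symmetric hexagon mesh. -/
def lambdaStar (d : ℝ) : ℝ :=
  (hexStiffness (hexPosition d) (Sum.inl 1) (Sum.inl 1) -
      2 * hexStiffness (hexPosition d) (Sum.inl 1) (Sum.inl 2)) /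
    (hexMass (hexPosition d) (Sum.inl 1) (Sum.inl 1) -
      2 * hexMass (hexPosition d) (Sum.inl 1) (Sum.inl 2))

/-- The vector `u_I` on the interior nodes. -/
def innerVector : Fin 7 → ℝ := ![0, 1, -1, 1, -1, 1, -1]

/-- The vector `û_B` on the boundary nodes. -/
def boundaryVector : Fin 6 → ℝ := ![1, -1, 1, -1, 1, -1]

end P1FEM

end

open P1FEM

/-!
Suppose that unique continuation fails for parameters `s → 0`: there are pairs `(μ, ν)` and vectors
`v` on the interior nodes, both of norm one, such that `μ A(s) - ν M(s)` annihilates the extension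
of `v` by zero. By compactness they accumulate at such a pair and vector for the symmetric mesh,
where `μ ≠ 0` because the mass matrix is positive definite; thus the limit is an inner solution
with the eigenvalue `ν / μ`.

The symmetric mesh has only the inner solutions `c • innerVector`, at the eigenvalue `lambdaStar d`
(`eq_smul_innerVector_of_mem_innerSolutions`). Indeed an eigenvalue `lam` of an inner solution is a
Rayleigh quotient, hence nonnegative. The angles opposite to an edge between the two rings are base
angles of isosceles triangles, hence acute, so that the stiffness entry `a` of such an edge is
negative; its mass entry `m` is positive, and `a - lam m` does not vanish. Each
boundary node sees two interior nodes with this same coefficient, so the solution alternates along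
the inner ring. The equations on the inner ring then give the value zero at the centre and the
eigenvalue `lambdaStar d`.

For the same reason `boundaryVector` annihilates the block `BI` of both matrices at `s = 0`
(`assemble_toBlocks₂₁_mulVec_dotProduct_boundaryVector`). Testing the boundary equations at `s` with
`boundaryVector`, dividing by `s` and passing to the limit yields a nonzero multiple of the pairing
that is assumed not to vanish, a contradiction. This argument, without sequences, is
`eventually_innerSolutions_eq_bot`.

The matrices are differentiable at `s = 0` because the integrals over a nondegenerate triangle have
closed forms (`stiffness_eq_assemble`, `mass_eq_assemble`). These forms also show that on the
symmetric mesh the local matrices depend only on the family of the triangle.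
-/

open MeasureTheory Filter Topology

namespace P1FEM

/-! ### Integrals over a triangle -/

/-- Twice the signed area of the triangle with the vertices `p 0, p 1, p 2`. -/
def doubleArea (p : Fin 3 → Plane) : ℝ :=
  (p 1 0 - p 0 0) * (p 2 1 - p 0 1) - (p 2 0 - p 0 0) * (p 1 1 - p 0 1)

/-- The reference triangle with the vertices `(0, 0), (1, 0), (0, 1)`. -/
def refTriangle : Set Plane := {y | 0 ≤ y 0 ∧ 0 ≤ y 1 ∧ y 0 + y 1 ≤ 1}

/-- The linear part of the affine map that sends the reference triangle to the triangle with the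
vertices `p 0, p 1, p 2`. -/
noncomputable def edgeMap (p : Fin 3 → Plane) : Plane →L[ℝ] Plane :=
  (Matrix.toEuclideanLin
    !![p 1 0 - p 0 0, p 2 0 - p 0 0; p 1 1 - p 0 1, p 2 1 - p 0 1]).toContinuousLinearMap

theorem edgeMap_apply (p : Fin 3 → Plane) (y : Plane) :
    edgeMap p y = y 0 • (p 1 - p 0) + y 1 • (p 2 - p 0) := by
  ext i
  fin_cases i <;>
    simp [edgeMap, Matrix.toEuclideanLin, Matrix.toLpLin, dotProduct, Fin.sum_univ_two] <;> ring

theorem det_edgeMap (p : Fin 3 → Plane) : (edgeMap p).det = doubleArea p := by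
  simp only [edgeMap, ContinuousLinearMap.det, LinearMap.coe_toContinuousLinearMap,
    Matrix.toEuclideanLin]
  rw [Matrix.toLpLin_eq_toLin, LinearMap.det_toLin, Matrix.det_fin_two_of, doubleArea]

theorem measurableSet_refTriangle : MeasurableSet refTriangle := by
  have h0 : Continuous fun y : Plane => y 0 := by fun_prop
  have h1 : Continuous fun y : Plane => y 1 := by fun_prop
  exact ((isClosed_le continuous_const h0).inter ((isClosed_le continuous_const h1).inter
    (isClosed_le (h0.add h1) continuous_const))).measurableSet

theorem convexHull_eq_image_refTriangle (p : Fin 3 → Plane) :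
    convexHull ℝ (Set.range p) = (fun y => p 0 + edgeMap p y) '' refTriangle := by
  apply Set.Subset.antisymm
  · refine convexHull_min ?_ ?_
    · rintro _ ⟨a, rfl⟩
      fin_cases a
      · exact ⟨!₂[0, 0], by simp [refTriangle], by simp [edgeMap_apply]⟩
      · exact ⟨!₂[1, 0], by simp [refTriangle], by simp [edgeMap_apply]⟩
      · exact ⟨!₂[0, 1], by simp [refTriangle], by simp [edgeMap_apply]⟩
    · have hconv : Convex ℝ refTriangle := by
        intro y hy z hz a b ha hb hab
        obtain ⟨h1, h2, h3⟩ := hy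
        obtain ⟨h4, h5, h6⟩ := hz
        refine ⟨?_, ?_, ?_⟩ <;> simp only [PiLp.add_apply, PiLp.smul_apply, smul_eq_mul]
        · positivity
        · positivity
        · nlinarith
      have := (hconv.linear_image (edgeMap p).toLinearMap).translate (p 0)
      rw [Set.image_image] at this
      simpa using this
  · rintro _ ⟨y, ⟨h1, h2, h3⟩, rfl⟩
    have hmem : ∀ a, p a ∈ convexHull ℝ (Set.range p) := fun a =>
      subset_convexHull ℝ _ ⟨a, rfl⟩
    have := (convex_convexHull ℝ (Set.range p)).sum_mem (t := Finset.univ)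
      (w := ![1 - y 0 - y 1, y 0, y 1]) (z := p)
      (by intro i _; fin_cases i <;> simp <;> linarith)
      (by simp [Fin.sum_univ_three]; ring) (fun i _ => hmem i)
    convert this using 1
    simp only [edgeMap_apply, Fin.sum_univ_three]
    simp
    module

theorem setIntegral_convexHull (p : Fin 3 → Plane) (hp : doubleArea p ≠ 0) (g : Plane → ℝ) :
    ∫ x in convexHull ℝ (Set.range p), g x =
      |doubleArea p| * ∫ y in refTriangle, g (p 0 + edgeMap p y) := by
  have hinj : Function.Injective (edgeMap p) := by
    rw [← det_edgeMap] at hp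
    have hu : IsUnit (LinearMap.det (edgeMap p).toLinearMap) := isUnit_iff_ne_zero.mpr hp
    exact (LinearEquiv.ofIsUnitDet (v := Module.finBasis ℝ Plane)
      (v' := Module.finBasis ℝ Plane) (f := (edgeMap p).toLinearMap)
      (by rwa [LinearMap.det_toMatrix])).injective
  rw [convexHull_eq_image_refTriangle, integral_image_eq_integral_abs_det_fderiv_smul volume
    measurableSet_refTriangle (f' := fun _ => edgeMap p)
    (fun y _ => ((edgeMap p).hasFDerivAt.const_add (p 0)).hasFDerivWithinAt)
    (fun y _ z _ h => hinj (by simpa using h))]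
  simp only [det_edgeMap, smul_eq_mul, integral_const_mul]

theorem setIntegral_refTriangle (f : ℝ → ℝ → ℝ) (hf : Continuous (Function.uncurry f)) :
    ∫ y in refTriangle, f (y 0) (y 1) = ∫ s in (0:ℝ)..1, ∫ t in (0:ℝ)..(1 - s), f s t := by
  let e : Plane ≃ᵐ ℝ × ℝ :=
    (MeasurableEquiv.toLp 2 (Fin 2 → ℝ)).symm.trans MeasurableEquiv.finTwoArrow
  have he : MeasurePreserving e :=
    (EuclideanSpace.volume_preserving_symm_measurableEquiv_toLp (Fin 2)).trans
      (volume_preserving_finTwoArrow ℝ)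
  let S : Set (ℝ × ℝ) := {z | 0 ≤ z.1 ∧ 0 ≤ z.2 ∧ z.1 + z.2 ≤ 1}
  have hSc : IsClosed S :=
    (isClosed_le continuous_const continuous_fst).inter
      ((isClosed_le continuous_const continuous_snd).inter
        (isClosed_le (continuous_fst.add continuous_snd) continuous_const))
  have hSm : MeasurableSet S := hSc.measurableSet
  have hSk : IsCompact S := by
    refine (isCompact_Icc (a := (0 : ℝ)) (b := 1)).prod (isCompact_Icc (a := (0 : ℝ)) (b := 1))
      |>.of_isClosed_subset hSc ?_
    rintro z ⟨h1, h2, h3⟩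
    exact ⟨⟨h1, by linarith⟩, ⟨h2, by linarith⟩⟩
  have h1 : ∫ y in refTriangle, f (y 0) (y 1) = ∫ z in S, Function.uncurry f z :=
    he.setIntegral_preimage_emb e.measurableEmbedding (Function.uncurry f) S
  rw [h1, ← integral_indicator hSm, Measure.volume_eq_prod, integral_prod]
  · rw [intervalIntegral.integral_of_le zero_le_one, ← integral_Icc_eq_integral_Ioc,
      ← integral_indicator measurableSet_Icc]
    congr 1
    ext s
    by_cases hs : s ∈ Set.Icc (0 : ℝ) 1
    · rw [Set.indicator_of_mem hs, intervalIntegral.integral_of_le (by linarith [hs.2]),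
        ← integral_Icc_eq_integral_Ioc, ← integral_indicator measurableSet_Icc]
      congr 1
      ext t
      have : (s, t) ∈ S ↔ t ∈ Set.Icc 0 (1 - s) := by
        constructor
        · rintro ⟨-, h2, h3⟩
          exact ⟨h2, by simp only at h3; linarith⟩
        · rintro ⟨h2, h3⟩
          exact ⟨hs.1, h2, by simp only; linarith⟩
      by_cases ht : t ∈ Set.Icc 0 (1 - s) <;> simp [Set.indicator, this, ht]
    · rw [Set.indicator_of_notMem hs]
      have : ∀ t, S.indicator (Function.uncurry f) (s, t) = 0 := by
        intro t
        refine Set.indicator_of_notMem (fun h => hs ⟨h.1, ?_⟩) _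
        have h2 := h.2.1
        have h3 := h.2.2
        simp only at h2 h3
        linarith
      simp [this]
  · rw [← Measure.volume_eq_prod]
    exact (hf.continuousOn.integrableOn_compact hSk).integrable_indicator hSm

/-- The barycentric coordinates on the reference triangle. -/
def baryCoord (a : Fin 3) (y : Plane) : ℝ := ![1 - y 0 - y 1, y 0, y 1] a

theorem setIntegral_refTriangle_quadratic (c₀ c₁ c₂ c₃ c₄ c₅ : ℝ) :
    ∫ y : Plane in refTriangle, (c₀ + c₁ * y 0 + c₂ * y 1 + c₃ * y 0 ^ 2 + c₄ * (y 0 * y 1)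
      + c₅ * y 1 ^ 2) = c₀ / 2 + c₁ / 6 + c₂ / 6 + c₃ / 12 + c₄ / 24 + c₅ / 12 := by
  rw [setIntegral_refTriangle (fun s t => c₀ + c₁ * s + c₂ * t + c₃ * s ^ 2 + c₄ * (s * t)
      + c₅ * t ^ 2) (by unfold Function.uncurry; fun_prop)]
  have hinner : ∀ s : ℝ, ∫ t in (0:ℝ)..(1 - s), (c₀ + c₁ * s + c₂ * t + c₃ * s ^ 2
      + c₄ * (s * t) + c₅ * t ^ 2) = (c₀ + c₁ * s + c₃ * s ^ 2) * (1 - s)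
        + (c₂ + c₄ * s) * ((1 - s) ^ 2 / 2) + c₅ * ((1 - s) ^ 3 / 3) := by
    intro s
    have : ∀ t : ℝ, HasDerivAt (fun t => (c₀ + c₁ * s + c₃ * s ^ 2) * t
        + (c₂ + c₄ * s) * (t ^ 2 / 2) + c₅ * (t ^ 3 / 3)) (c₀ + c₁ * s + c₂ * t + c₃ * s ^ 2
      + c₄ * (s * t) + c₅ * t ^ 2) t := by
      intro t
      have := (((hasDerivAt_id' t).const_mul (c₀ + c₁ * s + c₃ * s ^ 2)).add
        (((hasDerivAt_pow 2 t).div_const 2).const_mul (c₂ + c₄ * s))).add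
        (((hasDerivAt_pow 3 t).div_const 3).const_mul c₅)
      exact this.congr_deriv (by push_cast; ring)
    rw [intervalIntegral.integral_eq_sub_of_hasDerivAt (fun t _ => this t)
      (Continuous.intervalIntegrable (by fun_prop) _ _)]
    ring
  simp only [hinner]
  have : ∀ s : ℝ, HasDerivAt (fun s => (c₀ + c₂ / 2 + c₅ / 3) * s
      + (c₁ - c₀ + c₄ / 2 - c₂ - c₅) * (s ^ 2 / 2)
      + (c₃ - c₁ + c₂ / 2 - c₄ + c₅) * (s ^ 3 / 3) + (c₄ / 2 - c₃ - c₅ / 3) * (s ^ 4 / 4))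
      ((c₀ + c₁ * s + c₃ * s ^ 2) * (1 - s)
        + (c₂ + c₄ * s) * ((1 - s) ^ 2 / 2) + c₅ * ((1 - s) ^ 3 / 3)) s := by
    intro s
    have := ((((hasDerivAt_id' s).const_mul (c₀ + c₂ / 2 + c₅ / 3)).add
      (((hasDerivAt_pow 2 s).div_const 2).const_mul (c₁ - c₀ + c₄ / 2 - c₂ - c₅))).add
      (((hasDerivAt_pow 3 s).div_const 3).const_mul (c₃ - c₁ + c₂ / 2 - c₄ + c₅))).add
      (((hasDerivAt_pow 4 s).div_const 4).const_mul (c₄ / 2 - c₃ - c₅ / 3))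
    exact this.congr_deriv (by push_cast; ring)
  rw [intervalIntegral.integral_eq_sub_of_hasDerivAt (fun t _ => this t)
      (Continuous.intervalIntegrable (by fun_prop) _ _)]
  ring

theorem setIntegral_baryCoord_mul (a b : Fin 3) :
    ∫ y in refTriangle, baryCoord a y * baryCoord b y = (if a = b then 2 else 1) / 24 := by
  have key : ∃ c₀ c₁ c₂ c₃ c₄ c₅ : ℝ, (∀ y : Plane, baryCoord a y * baryCoord b y =
      c₀ + c₁ * y 0 + c₂ * y 1 + c₃ * y 0 ^ 2 + c₄ * (y 0 * y 1) + c₅ * y 1 ^ 2) ∧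
      c₀ / 2 + c₁ / 6 + c₂ / 6 + c₃ / 12 + c₄ / 24 + c₅ / 12
        = (if a = b then 2 else 1) / 24 := by
    -- The coefficients of the product of two barycentric coordinates.
    fin_cases a <;> fin_cases b
    · exact ⟨1, -2, -2, 1, 2, 1, fun y => by simp [baryCoord]; ring, by norm_num⟩
    · exact ⟨0, 1, 0, -1, -1, 0, fun y => by simp [baryCoord]; ring, by norm_num⟩
    · exact ⟨0, 0, 1, 0, -1, -1, fun y => by simp [baryCoord]; ring, by norm_num⟩
    · exact ⟨0, 1, 0, -1, -1, 0, fun y => by simp [baryCoord]; ring, by norm_num⟩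
    · exact ⟨0, 0, 0, 1, 0, 0, fun y => by simp [baryCoord]; ring, by norm_num⟩
    · exact ⟨0, 0, 0, 0, 1, 0, fun y => by simp [baryCoord], by norm_num⟩
    · exact ⟨0, 0, 1, 0, -1, -1, fun y => by simp [baryCoord]; ring, by norm_num⟩
    · exact ⟨0, 0, 0, 0, 1, 0, fun y => by simp [baryCoord]; ring, by norm_num⟩
    · exact ⟨0, 0, 0, 0, 0, 1, fun y => by simp [baryCoord]; ring, by norm_num⟩
  obtain ⟨c₀, c₁, c₂, c₃, c₄, c₅, h, hc⟩ := key
  simp only [h]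
  rw [setIntegral_refTriangle_quadratic, hc]

theorem setIntegral_refTriangle_const (c : ℝ) : ∫ _ in refTriangle, c = c * (1 / 2) := by
  simpa [div_eq_mul_inv] using setIntegral_refTriangle_quadratic c 0 0 0 0 0

/-! ### Nodal functions and the assembled matrices -/

theorem nodalFunction_edgeMap (p : Fin 3 → Plane) (hp : doubleArea p ≠ 0) (a : Fin 3) (y : Plane) :
    nodalFunction p a (p 0 + edgeMap p y) = baryCoord a y := by
  unfold nodalFunction baryCoord
  rw [div_eq_iff]
  · fin_cases a <;> simp [edgeMap_apply] <;> ring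
  · rw [doubleArea] at hp
    contrapose! hp
    rw [← hp]
    fin_cases a <;> simp <;> ring

/-- The gradient of the nodal function of the vertex `p a`: the opposite edge, turned by a right
angle and divided by twice the signed area. -/
noncomputable def nodalGradient (p : Fin 3 → Plane) (a : Fin 3) : Plane :=
  !₂[(p (a + 1) 1 - p (a + 2) 1) / doubleArea p, (p (a + 2) 0 - p (a + 1) 0) / doubleArea p]

theorem hasGradientAt_nodalFunction (p : Fin 3 → Plane) (a : Fin 3) (x : Plane) :
    HasGradientAt (nodalFunction p a) (nodalGradient p a) x := by
  have h : nodalFunction p a = fun x => inner ℝ (nodalGradient p a) x +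
      (p (a + 1) 0 * p (a + 2) 1 - p (a + 2) 0 * p (a + 1) 1) / doubleArea p := by
    ext x
    have hD : (p (a + 1) 0 - p a 0) * (p (a + 2) 1 - p a 1) -
        (p (a + 2) 0 - p a 0) * (p (a + 1) 1 - p a 1) = doubleArea p := by
      rw [doubleArea]
      fin_cases a <;> simp <;> ring
    rw [nodalFunction, hD]
    simp [nodalGradient, PiLp.inner_apply, Fin.sum_univ_two]
    ring
  rw [h, hasGradientAt_iff_hasFDerivAt]
  exact ((InnerProductSpace.toDual ℝ Plane (nodalGradient p a)).hasFDerivAt (x := x)).add_const _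

section Assembly

variable {V τ : Type} [DecidableEq V] [Fintype τ]

/-- The global matrix assembled from the local matrices `W t` of the triangles `tri t`. -/
def assemble (tri : τ → Fin 3 → V) (W : τ → Matrix (Fin 3) (Fin 3) ℝ) : Matrix V V ℝ :=
  Matrix.of fun i j => ∑ t, ∑ b, ∑ a, if tri t b = i then if tri t a = j then W t b a else 0 else 0

/-- The local stiffness matrix of a triangle, in terms of the edges opposite to the vertices. -/
noncomputable def localStiffness (p : Fin 3 → Plane) : Matrix (Fin 3) (Fin 3) ℝ :=
  Matrix.of fun b a =>
    inner ℝ (p (a + 1) - p (a + 2)) (p (b + 1) - p (b + 2)) / (2 * |doubleArea p|)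

/-- The local mass matrix of a triangle. -/
noncomputable def localMass (p : Fin 3 → Plane) : Matrix (Fin 3) (Fin 3) ℝ :=
  Matrix.of fun b a => |doubleArea p| * ((if a = b then 2 else 1) / 24)

theorem gradient_basisOn (X : V → Plane) (T : Fin 3 → V) (v : V) (x : Plane) :
    gradient (basisOn X T v) x =
      ∑ a, if T a = v then nodalGradient (fun b => X (T b)) a else 0 := by
  refine HasGradientAt.gradient ?_
  rw [hasGradientAt_iff_hasFDerivAt, map_sum]
  unfold basisOn
  refine HasFDerivAt.fun_sum fun a _ => ?_
  split_ifs
  · exact (hasGradientAt_nodalFunction _ a x).hasFDerivAt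
  · simpa using hasFDerivAt_const (0 : ℝ) x

theorem inner_nodalGradient (p : Fin 3 → Plane) (hp : doubleArea p ≠ 0) (a b : Fin 3) :
    |doubleArea p| * (inner ℝ (nodalGradient p a) (nodalGradient p b) * (1 / 2)) =
      localStiffness p b a := by
  simp only [nodalGradient, localStiffness, PiLp.inner_apply, Fin.sum_univ_two, Matrix.of_apply]
  have h : doubleArea p ^ 2 = |doubleArea p| ^ 2 := (sq_abs _).symm
  have h0 : |doubleArea p| ≠ 0 := abs_ne_zero.mpr hp
  simp
  field_simp
  rw [h]
  ring

theorem stiffness_eq_assemble (tri : τ → Fin 3 → V) (X : V → Plane)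
    (h : ∀ t, doubleArea (fun a => X (tri t a)) ≠ 0) :
    stiffness tri X = assemble tri fun t => localStiffness fun a => X (tri t a) := by
  ext i j
  simp only [stiffness, assemble, Matrix.of_apply, gradient_basisOn, element]
  refine Finset.sum_congr rfl fun t _ => ?_
  rw [setIntegral_convexHull _ (h t)]
  rw [setIntegral_refTriangle_const,
    inner_sum (𝕜 := ℝ), Finset.sum_mul, Finset.mul_sum]
  refine Finset.sum_congr rfl fun b _ => ?_
  rw [sum_inner (𝕜 := ℝ), Finset.sum_mul, Finset.mul_sum]
  refine Finset.sum_congr rfl fun a _ => ?_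
  rw [← inner_nodalGradient _ (h t)]
  split_ifs <;> simp

theorem mass_eq_assemble (tri : τ → Fin 3 → V) (X : V → Plane)
    (h : ∀ t, doubleArea (fun a => X (tri t a)) ≠ 0) :
    mass tri X = assemble tri fun t => localMass fun a => X (tri t a) := by
  have hK : IsCompact refTriangle := by
    have : refTriangle = convexHull ℝ (Set.range ![(0 : Plane), !₂[1, 0], !₂[0, 1]]) := by
      rw [convexHull_eq_image_refTriangle]
      symm
      convert Set.image_id refTriangle
      rename_i y
      ext i
      fin_cases i <;> simp [edgeMap_apply]
    rw [this]
    exact (Set.finite_range _).isCompact_convexHull (𝕜 := ℝ)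
  ext i j
  simp only [mass, assemble, Matrix.of_apply, basisOn, element]
  refine Finset.sum_congr rfl fun t _ => ?_
  rw [setIntegral_convexHull _ (h t)]
  simp only [nodalFunction_edgeMap _ (h t), Finset.sum_mul_sum]
  have hc : ∀ a, Continuous (baryCoord a) := by
    intro a
    unfold baryCoord
    fin_cases a <;> simp <;> fun_prop
  have hint : ∀ a b : Fin 3, IntegrableOn (fun y => (if tri t a = j then baryCoord a y else 0) *
      (if tri t b = i then baryCoord b y else 0)) refTriangle := by
    intro a b
    refine ContinuousOn.integrableOn_compact hK (Continuous.continuousOn ?_)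
    split_ifs <;> (try simp only [mul_zero, zero_mul]) <;>
      first | exact (hc a).mul (hc b) | exact continuous_const
  rw [integral_finsetSum _ fun a _ => integrable_finsetSum _ fun b _ => hint a b, Finset.mul_sum]
  rw [Finset.sum_comm (f := fun b a => if tri t b = i then _ else _)]
  refine Finset.sum_congr rfl fun a _ => ?_
  rw [integral_finsetSum _ fun b _ => hint a b, Finset.mul_sum]
  refine Finset.sum_congr rfl fun b _ => ?_
  split_ifs <;> simp [localMass, setIntegral_baryCoord_mul]

end Assembly

/-! ### Quadratic forms of assembled matrices -/

section Assembly

variable {V τ : Type} [DecidableEq V] [Fintype τ]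

theorem assemble_sub_smul (tri : τ → Fin 3 → V) (W W' : τ → Matrix (Fin 3) (Fin 3) ℝ) (c : ℝ) :
    assemble tri W - c • assemble tri W' = assemble tri fun t => W t - c • W' t := by
  ext i j
  simp only [assemble, Matrix.sub_apply, Matrix.smul_apply, Matrix.of_apply, smul_eq_mul,
    Finset.mul_sum, ← Finset.sum_sub_distrib]
  refine Finset.sum_congr rfl fun t _ => Finset.sum_congr rfl fun b _ =>
    Finset.sum_congr rfl fun a _ => ?_
  split_ifs <;> simp

variable [Fintype V]

theorem assemble_mulVec (tri : τ → Fin 3 → V) (W : τ → Matrix (Fin 3) (Fin 3) ℝ) (u : V → ℝ)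
    (i : V) : (assemble tri W *ᵥ u) i =
      ∑ t, ∑ b, if tri t b = i then ∑ a, W t b a * u (tri t a) else 0 := by
  simp only [Matrix.mulVec, dotProduct, assemble, Matrix.of_apply, Finset.sum_mul]
  rw [Finset.sum_comm]
  refine Finset.sum_congr rfl fun t _ => ?_
  rw [Finset.sum_comm]
  refine Finset.sum_congr rfl fun b _ => ?_
  rw [Finset.sum_comm]
  split_ifs with h
  · refine Finset.sum_congr rfl fun a _ => ?_
    simp [ite_mul]
  · simp

/-- The bilinear form of an assembled matrix is the sum of the local bilinear forms. -/
theorem dotProduct_assemble_mulVec (tri : τ → Fin 3 → V) (W : τ → Matrix (Fin 3) (Fin 3) ℝ)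
    (w u : V → ℝ) : w ⬝ᵥ (assemble tri W *ᵥ u) =
      ∑ t, (fun b => w (tri t b)) ⬝ᵥ (W t *ᵥ fun a => u (tri t a)) := by
  simp only [dotProduct, assemble_mulVec, Finset.mul_sum (s := Finset.univ (α := τ))]
  rw [Finset.sum_comm]
  refine Finset.sum_congr rfl fun t _ => ?_
  simp only [Finset.mul_sum (s := Finset.univ (α := Fin 3)), Matrix.mulVec, dotProduct]
  rw [Finset.sum_comm]
  refine Finset.sum_congr rfl fun b _ => ?_
  simp [mul_ite, Finset.mul_sum]

end Assembly

/-- The quadratic form of the local stiffness matrix is the squared norm of a combination of the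
edges. -/
theorem dotProduct_localStiffness_mulVec_nonneg (p : Fin 3 → Plane) (u : Fin 3 → ℝ) :
    0 ≤ u ⬝ᵥ (localStiffness p *ᵥ u) := by
  have : u ⬝ᵥ (localStiffness p *ᵥ u) =
      inner ℝ (∑ a, u a • (p (a + 1) - p (a + 2))) (∑ a, u a • (p (a + 1) - p (a + 2))) /
        (2 * |doubleArea p|) := by
    simp only [dotProduct, Matrix.mulVec, localStiffness, Matrix.of_apply, sum_inner (𝕜 := ℝ),
      inner_sum (𝕜 := ℝ), real_inner_smul_left, real_inner_smul_right, Finset.mul_sum,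
      Finset.sum_div]
    rw [Finset.sum_comm]
    refine Finset.sum_congr rfl fun b _ => Finset.sum_congr rfl fun a _ => ?_
    ring
  rw [this]
  exact div_nonneg real_inner_self_nonneg (by positivity)

theorem dotProduct_localMass_mulVec (p : Fin 3 → Plane) (u : Fin 3 → ℝ) :
    u ⬝ᵥ (localMass p *ᵥ u) =
      |doubleArea p| / 24 * ((u 0 + u 1 + u 2) ^ 2 + (u 0 ^ 2 + u 1 ^ 2 + u 2 ^ 2)) := by
  simp [dotProduct, Matrix.mulVec, localMass, Fin.sum_univ_three]
  ring

section Blocks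

variable {I B : Type} [Fintype I] [Fintype B]

/-- Inner solutions are the vectors whose extension by zero solves the discrete
Neumann problem. -/
theorem mem_innerSolutions_iff (A M : Matrix (I ⊕ B) (I ⊕ B) ℝ) (lam : ℝ) (v : I → ℝ) :
    v ∈ innerSolutions A M lam ↔ (A - lam • M) *ᵥ Sum.elim v 0 = 0 := by
  have h1 : ∀ i, ((A - lam • M) *ᵥ Sum.elim v 0) (Sum.inl i) =
      ((A.toBlocks₁₁ - lam • M.toBlocks₁₁) *ᵥ v) i := by
    intro i
    simp [Matrix.mulVec, dotProduct, Matrix.toBlocks₁₁]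
  have h2 : ∀ i, ((A - lam • M) *ᵥ Sum.elim v 0) (Sum.inr i) =
      ((A.toBlocks₂₁ - lam • M.toBlocks₂₁) *ᵥ v) i := by
    intro i
    simp [Matrix.mulVec, dotProduct, Matrix.toBlocks₂₁]
  simp only [innerSolutions, Submodule.mem_inf, LinearMap.mem_ker, Matrix.mulVecLin_apply,
    funext_iff, Sum.forall, h1, h2, Pi.zero_apply]

end Blocks

/-! ### The stiffness and mass matrices of a hexagon mesh -/

theorem hexStiffness_eq_assemble (X : HexNode → Plane)
    (h : ∀ t, doubleArea (fun a => X (hexTriangle t a)) ≠ 0) :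
    hexStiffness X = assemble hexTriangle fun t => localStiffness fun a => X (hexTriangle t a) :=
  stiffness_eq_assemble hexTriangle X h

theorem hexMass_eq_assemble (X : HexNode → Plane)
    (h : ∀ t, doubleArea (fun a => X (hexTriangle t a)) ≠ 0) :
    hexMass X = assemble hexTriangle fun t => localMass fun a => X (hexTriangle t a) :=
  mass_eq_assemble hexTriangle X h

theorem dotProduct_hexStiffness_mulVec_nonneg (X : HexNode → Plane)
    (h : ∀ t, doubleArea (fun a => X (hexTriangle t a)) ≠ 0) (u : HexNode → ℝ) :
    0 ≤ u ⬝ᵥ (hexStiffness X *ᵥ u) := by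
  rw [hexStiffness_eq_assemble X h, dotProduct_assemble_mulVec]
  exact Finset.sum_nonneg fun t _ => dotProduct_localStiffness_mulVec_nonneg _ _

theorem dotProduct_hexMass_mulVec_pos (X : HexNode → Plane)
    (h : ∀ t, doubleArea (fun a => X (hexTriangle t a)) ≠ 0) (u : HexNode → ℝ) (hu : u ≠ 0) :
    0 < u ⬝ᵥ (hexMass X *ᵥ u) := by
  rw [hexMass_eq_assemble X h, dotProduct_assemble_mulVec]
  have hnn : ∀ t ∈ Finset.univ, 0 ≤ (fun b => u (hexTriangle t b)) ⬝ᵥ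
      (localMass (fun a => X (hexTriangle t a)) *ᵥ fun a => u (hexTriangle t a)) := by
    intro t _
    rw [dotProduct_localMass_mulVec]
    positivity
  refine (Finset.sum_nonneg hnn).lt_of_ne' fun h0 => hu ?_
  rw [Finset.sum_eq_zero_iff_of_nonneg hnn] at h0
  have hz : ∀ t a, u (hexTriangle t a) = 0 := by
    intro t a
    have ht := h0 t (Finset.mem_univ t)
    rw [dotProduct_localMass_mulVec] at ht
    have hp : |doubleArea fun a => X (hexTriangle t a)| / 24 ≠ 0 :=
      div_ne_zero (abs_ne_zero.mpr (h t)) (by norm_num)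
    have ht := (mul_eq_zero.mp ht).resolve_left hp
    have := sq_nonneg (u (hexTriangle t 0) + u (hexTriangle t 1) + u (hexTriangle t 2))
    have ha : u (hexTriangle t a) ^ 2 ≤ 0 := by
      have h0 := sq_nonneg (u (hexTriangle t 0))
      have h1 := sq_nonneg (u (hexTriangle t 1))
      have h2 := sq_nonneg (u (hexTriangle t 2))
      match a with
      | 0 | 1 | 2 => linarith
    exact pow_eq_zero_iff (two_ne_zero) |>.mp (le_antisymm ha (sq_nonneg _))
  ext i
  rcases i with i | k
  · refine Fin.cases ?_ (fun k => ?_) i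
    · exact hz (0, 0) 0
    · exact hz (0, k) 1
  · exact hz (2, k) 1

/-! ### Rotationally invariant hexagon matrices -/

/-- The rows of the boundary nodes, applied to a vector that vanishes on the boundary. -/
theorem assemble_hexTriangle_mulVec_inr (W : Fin 3 → Matrix (Fin 3) (Fin 3) ℝ)
    (v : Fin 7 → ℝ) (k : Fin 6) :
    (assemble hexTriangle (fun t => W t.1) *ᵥ Sum.elim v 0) (Sum.inr k) =
      (W 1 2 0 + W 2 2 0) * v (k - 1).succ + (W 1 2 1 + W 2 1 0) * v k.succ := by
  rw [assemble_mulVec, Fintype.sum_prod_type]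
  simp only [Fin.sum_univ_three, hexTriangle]
  simp [← eq_sub_iff_add_eq, Finset.sum_add_distrib]
  ring

/-- The rows of the inner ring, applied to a vector that vanishes on the boundary. -/
theorem assemble_hexTriangle_mulVec_ring (W : Fin 3 → Matrix (Fin 3) (Fin 3) ℝ)
    (v : Fin 7 → ℝ) (k : Fin 6) :
    (assemble hexTriangle (fun t => W t.1) *ᵥ Sum.elim v 0) (Sum.inl k.succ) =
      (W 0 1 0 + W 0 2 0) * v 0 +
      (W 0 1 1 + W 0 2 2 + W 1 0 0 + W 1 1 1 + W 2 0 0) * v k.succ +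
      (W 0 1 2 + W 1 0 1) * v (k + 1).succ + (W 0 2 1 + W 1 1 0) * v (k - 1).succ := by
  rw [assemble_mulVec, Fintype.sum_prod_type]
  simp only [Fin.sum_univ_three, hexTriangle]
  simp [← eq_sub_iff_add_eq, Finset.sum_add_distrib, (Fin.succ_ne_zero _).symm]
  ring

/-- The diagonal entry `a₂₂` of an inner ring node. -/
theorem assemble_hexTriangle_apply_ring (W : Fin 3 → Matrix (Fin 3) (Fin 3) ℝ) :
    assemble hexTriangle (fun t => W t.1) (Sum.inl 1) (Sum.inl 1) =
      W 0 1 1 + W 0 2 2 + W 1 0 0 + W 1 1 1 + W 2 0 0 := by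
  have h := assemble_hexTriangle_mulVec_ring W (Pi.single 1 1) 0
  have h2 : Sum.elim (Pi.single 1 1 : Fin 7 → ℝ) (0 : Fin 6 → ℝ) = Pi.single (Sum.inl 1) 1 := by
    simp
  rw [h2, Matrix.mulVec_single_one] at h
  simpa [Fin.succ_ne_zero, Pi.single_apply, Fin.ext_iff] using h

/-- The entry `a₂₃` of two neighbouring inner ring nodes. -/
theorem assemble_hexTriangle_apply_ring_next (W : Fin 3 → Matrix (Fin 3) (Fin 3) ℝ) :
    assemble hexTriangle (fun t => W t.1) (Sum.inl 1) (Sum.inl 2) = W 0 1 2 + W 1 0 1 := by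
  have h := assemble_hexTriangle_mulVec_ring W (Pi.single 2 1) 0
  have h2 : Sum.elim (Pi.single 2 1 : Fin 7 → ℝ) (0 : Fin 6 → ℝ) = Pi.single (Sum.inl 2) 1 := by
    simp
  rw [h2, Matrix.mulVec_single_one] at h
  simpa [Fin.succ_ne_zero, Pi.single_apply, Fin.ext_iff] using h

/-! ### Geometry of the symmetric hexagon mesh -/

/-- The index wraps around by `6`, hence the angles of the nodes by a full turn. -/
theorem cast_val_add_one_fin_six (k : Fin 6) :
    (((k + 1 : Fin 6) : ℕ) : ℝ) = (k : ℕ) + 1 ∨ (((k + 1 : Fin 6) : ℕ) : ℝ) = (k : ℕ) + 1 - 6 := by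
  fin_cases k <;> norm_num [Fin.val_add]

/-- In terms of the direction `(c, s)` of the inner node `k`, the four nodes of the triangles with
the index `k`. -/
theorem exists_hexPosition_eq (d : ℝ) (k : Fin 6) : ∃ c s : ℝ, c ^ 2 + s ^ 2 = 1 ∧
    hexPosition d (Sum.inl k.succ) = !₂[c, s] ∧
    hexPosition d (Sum.inl (k + 1).succ) = !₂[c / 2 - √3 / 2 * s, s / 2 + √3 / 2 * c] ∧
    hexPosition d (Sum.inr k) = !₂[d * (√3 / 2 * c + s / 2), d * (√3 / 2 * s - c / 2)] ∧
    hexPosition d (Sum.inr (k + 1)) =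
      !₂[d * (√3 / 2 * c - s / 2), d * (√3 / 2 * s + c / 2)] := by
  refine ⟨Real.cos ((k : ℕ) * Real.pi / 3), Real.sin ((k : ℕ) * Real.pi / 3),
    Real.cos_sq_add_sin_sq _, by simp [hexPosition], ?_, ?_, ?_⟩
  · have h : ∀ x : ℝ, x = (k : ℕ) + 1 ∨ x = (k : ℕ) + 1 - 6 →
        Real.cos (x * Real.pi / 3) = Real.cos ((k : ℕ) * Real.pi / 3 + Real.pi / 3) ∧
        Real.sin (x * Real.pi / 3) = Real.sin ((k : ℕ) * Real.pi / 3 + Real.pi / 3) := by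
      rintro x (rfl | rfl)
      · constructor <;> congr 1 <;> ring
      · rw [← Real.cos_sub_two_pi ((k : ℕ) * Real.pi / 3 + Real.pi / 3),
          ← Real.sin_sub_two_pi ((k : ℕ) * Real.pi / 3 + Real.pi / 3)]
        constructor <;> congr 1 <;> ring
    obtain ⟨h1, h2⟩ := h _ (cast_val_add_one_fin_six k)
    simp only [hexPosition, Fin.cases_succ, h1, h2, Real.cos_add, Real.sin_add,
      Real.cos_pi_div_three, Real.sin_pi_div_three]
    congr 2
    · ring
    · congr 1
      ring
  · have h : (2 * ((k : ℕ) : ℝ) - 1) * Real.pi / 6 = (k : ℕ) * Real.pi / 3 - Real.pi / 6 := by ring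
    simp only [hexPosition, h, Real.cos_sub, Real.sin_sub,
      Real.cos_pi_div_six, Real.sin_pi_div_six]
    congr 2
    · ring
    · congr 1
      ring
  · have h : ∀ x : ℝ, x = (k : ℕ) + 1 ∨ x = (k : ℕ) + 1 - 6 →
        Real.cos ((2 * x - 1) * Real.pi / 6) = Real.cos ((k : ℕ) * Real.pi / 3 + Real.pi / 6) ∧
        Real.sin ((2 * x - 1) * Real.pi / 6) = Real.sin ((k : ℕ) * Real.pi / 3 + Real.pi / 6) := by
      rintro x (rfl | rfl)
      · constructor <;> congr 1 <;> ring
      · rw [← Real.cos_sub_two_pi ((k : ℕ) * Real.pi / 3 + Real.pi / 6),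
          ← Real.sin_sub_two_pi ((k : ℕ) * Real.pi / 3 + Real.pi / 6)]
        constructor <;> congr 1 <;> ring
    obtain ⟨h1, h2⟩ := h _ (cast_val_add_one_fin_six k)
    simp only [hexPosition, h1, h2, Real.cos_add, Real.sin_add,
      Real.cos_pi_div_six, Real.sin_pi_div_six]
    congr 2
    · ring
    · congr 1
      ring

theorem hexPosition_center (d : ℝ) : hexPosition d (Sum.inl 0) = !₂[0, 0] := rfl

/-- Twice the signed areas of the triangles of the symmetric hexagon mesh, for each family. The
triangles of the second family are listed clockwise. -/
noncomputable def hexDoubleArea (d : ℝ) : Fin 3 → ℝ :=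
  ![√3 / 2, √3 / 2 - d, d * (√3 / 2 * d - 1)]

/-- The inner products of the edges opposite to the vertices in the triangles of the symmetric
hexagon mesh, for each family. -/
noncomputable def hexEdgeGram (d : ℝ) : Fin 3 → Matrix (Fin 3) (Fin 3) ℝ :=
  ![!![1, -1 / 2, -1 / 2;
       -1 / 2, 1, -1 / 2;
       -1 / 2, -1 / 2, 1],
    !![d ^ 2 - √3 * d + 1, √3 * d - d ^ 2 - 1 / 2, -1 / 2;
       √3 * d - d ^ 2 - 1 / 2, d ^ 2 - √3 * d + 1, -1 / 2;
       -1 / 2, -1 / 2, 1],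
    !![d ^ 2, -d ^ 2 / 2, -d ^ 2 / 2;
       -d ^ 2 / 2, d ^ 2 - √3 * d + 1, √3 * d - d ^ 2 / 2 - 1;
       -d ^ 2 / 2, √3 * d - d ^ 2 / 2 - 1, d ^ 2 - √3 * d + 1]]

theorem doubleArea_hexPosition (d : ℝ) (t : Fin 3 × Fin 6) :
    doubleArea (fun a => hexPosition d (hexTriangle t a)) = hexDoubleArea d t.1 := by
  obtain ⟨f, k⟩ := t
  obtain ⟨c, s, hcs, h1, h2, h3, h4⟩ := exists_hexPosition_eq d k
  have h5 : √3 ^ 2 = 3 := Real.sq_sqrt (by norm_num)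
  fin_cases f <;>
    simp [doubleArea, hexTriangle, hexDoubleArea, h1, h2, h3, h4, hexPosition_center] <;>
    clear h1 h2 h3 h4 <;> generalize √3 = r at * <;> grind

theorem inner_edge_hexPosition (d : ℝ) (t : Fin 3 × Fin 6) (a b : Fin 3) :
    inner ℝ (hexPosition d (hexTriangle t (a + 1)) - hexPosition d (hexTriangle t (a + 2)))
      (hexPosition d (hexTriangle t (b + 1)) - hexPosition d (hexTriangle t (b + 2))) =
      hexEdgeGram d t.1 b a := by
  obtain ⟨f, k⟩ := t
  obtain ⟨c, s, hcs, h1, h2, h3, h4⟩ := exists_hexPosition_eq d k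
  have h5 : √3 ^ 2 = 3 := Real.sq_sqrt (by norm_num)
  simp only [PiLp.inner_apply, Fin.sum_univ_two, PiLp.sub_apply]
  fin_cases f <;> fin_cases a <;> fin_cases b <;>
    simp [hexTriangle, hexEdgeGram, h1, h2, h3, h4, hexPosition_center] <;>
    clear h1 h2 h3 h4 <;> generalize √3 = r at * <;> grind

/-! ### Inner solutions on the symmetric hexagon mesh -/

/-- The local stiffness matrices of the symmetric hexagon mesh, for each family of triangles. -/
noncomputable def hexLocalStiffness (d : ℝ) (f : Fin 3) : Matrix (Fin 3) (Fin 3) ℝ :=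
  Matrix.of fun b a => hexEdgeGram d f b a / (2 * |hexDoubleArea d f|)

/-- The local mass matrices of the symmetric hexagon mesh, for each family of triangles. -/
noncomputable def hexLocalMass (d : ℝ) (f : Fin 3) : Matrix (Fin 3) (Fin 3) ℝ :=
  Matrix.of fun b a => |hexDoubleArea d f| * ((if a = b then 2 else 1) / 24)

theorem hexDoubleArea_ne_zero {d : ℝ} (hd : 2 / √3 < d) (f : Fin 3) : hexDoubleArea d f ≠ 0 := by
  have hr : 0 < √3 := by positivity
  have hr3 : √3 ^ 2 = 3 := Real.sq_sqrt (by norm_num)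
  have h1 : 2 < d * √3 := (div_lt_iff₀ hr).mp hd
  have hd0 : 0 < d := lt_trans (by positivity) hd
  match f with
  | 0 => exact (by positivity : (√3 / 2 : ℝ) ≠ 0)
  | 1 =>
    refine (?_ : (√3 / 2 - d : ℝ) < 0).ne
    nlinarith
  | 2 => exact (mul_pos hd0 (by linarith) : 0 < d * (√3 / 2 * d - 1)).ne'

theorem doubleArea_hexPosition_ne_zero {d : ℝ} (hd : 2 / √3 < d) (t : Fin 3 × Fin 6) :
    doubleArea (fun a => hexPosition d (hexTriangle t a)) ≠ 0 := by
  rw [doubleArea_hexPosition]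
  exact hexDoubleArea_ne_zero hd _

theorem hexStiffness_hexPosition {d : ℝ} (hd : 2 / √3 < d) :
    hexStiffness (hexPosition d) = assemble hexTriangle fun t => hexLocalStiffness d t.1 := by
  rw [hexStiffness_eq_assemble _ (doubleArea_hexPosition_ne_zero hd)]
  congr 1
  ext t b a
  simp only [localStiffness, hexLocalStiffness, Matrix.of_apply, doubleArea_hexPosition,
    inner_edge_hexPosition]

theorem hexMass_hexPosition {d : ℝ} (hd : 2 / √3 < d) :
    hexMass (hexPosition d) = assemble hexTriangle fun t => hexLocalMass d t.1 := by
  rw [hexMass_eq_assemble _ (doubleArea_hexPosition_ne_zero hd)]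
  congr 1
  ext t b a
  simp only [localMass, hexLocalMass, Matrix.of_apply, doubleArea_hexPosition]

theorem hexMass_mulVec_eq_zero {d : ℝ} (hd : 2 / √3 < d) (v : Fin 7 → ℝ)
    (h : hexMass (hexPosition d) *ᵥ Sum.elim v 0 = 0) : v = 0 := by
  by_contra hv
  have hu : Sum.elim v (0 : Fin 6 → ℝ) ≠ 0 := fun h => hv (by
    ext i
    exact congrFun h (Sum.inl i))
  have := dotProduct_hexMass_mulVec_pos _ (doubleArea_hexPosition_ne_zero hd) _ hu
  rw [h, dotProduct_zero] at this
  exact this.false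

/-- The eigenvalue of an inner solution is a Rayleigh quotient. -/
theorem nonneg_of_mem_innerSolutions {d : ℝ} (hd : 2 / √3 < d) {lam : ℝ} {v : Fin 7 → ℝ}
    (hv : v ∈ innerSolutions (hexStiffness (hexPosition d)) (hexMass (hexPosition d)) lam)
    (hv0 : v ≠ 0) : 0 ≤ lam := by
  rw [mem_innerSolutions_iff] at hv
  have hu : Sum.elim v (0 : Fin 6 → ℝ) ≠ 0 := fun h => hv0 (by
    ext i
    exact congrFun h (Sum.inl i))
  have hM := dotProduct_hexMass_mulVec_pos _ (doubleArea_hexPosition_ne_zero hd) _ hu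
  have hA := dotProduct_hexStiffness_mulVec_nonneg _ (doubleArea_hexPosition_ne_zero hd)
    (Sum.elim v (0 : Fin 6 → ℝ))
  rw [Matrix.sub_mulVec, sub_eq_zero, Matrix.smul_mulVec] at hv
  rw [hv, dotProduct_smul, smul_eq_mul] at hA
  exact nonneg_of_mul_nonneg_left hA hM

/-- On the symmetric mesh the only inner solutions are the multiples of the alternating vector,
at the eigenvalue `lambdaStar d`. -/
theorem eq_smul_innerVector_of_mem_innerSolutions {d : ℝ} (hd : 2 / √3 < d) {lam : ℝ}
    {v : Fin 7 → ℝ}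
    (hv : v ∈ innerSolutions (hexStiffness (hexPosition d)) (hexMass (hexPosition d)) lam)
    (hv0 : v ≠ 0) : lam = lambdaStar d ∧ ∃ c : ℝ, c ≠ 0 ∧ v = c • innerVector := by
  have hlam := nonneg_of_mem_innerSolutions hd hv hv0
  have hd0 : 0 < d := lt_trans (by positivity) hd
  have hD0 := abs_pos.mpr (hexDoubleArea_ne_zero hd 0)
  have hD1 := abs_pos.mpr (hexDoubleArea_ne_zero hd 1)
  have hD2 := abs_pos.mpr (hexDoubleArea_ne_zero hd 2)
  rw [mem_innerSolutions_iff, hexStiffness_hexPosition hd, hexMass_hexPosition hd,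
    assemble_sub_smul] at hv
  set W : Fin 3 → Matrix (Fin 3) (Fin 3) ℝ := fun f =>
    hexLocalStiffness d f - lam • hexLocalMass d f with hW
  have hB : ∀ k : Fin 6, (W 1 2 0 + W 2 2 0) * v (k - 1).succ + (W 1 2 1 + W 2 1 0) * v k.succ
      = 0 := fun k => by
    rw [← assemble_hexTriangle_mulVec_inr W v k]
    exact congrFun hv (Sum.inr k)
  have hR : ∀ k : Fin 6, (W 0 1 0 + W 0 2 0) * v 0 +
      (W 0 1 1 + W 0 2 2 + W 1 0 0 + W 1 1 1 + W 2 0 0) * v k.succ +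
      (W 0 1 2 + W 1 0 1) * v (k + 1).succ + (W 0 2 1 + W 1 1 0) * v (k - 1).succ
      = 0 := fun k => by
    rw [← assemble_hexTriangle_mulVec_ring W v k]
    exact congrFun hv (Sum.inl k.succ)
  have e1 : W 1 2 1 + W 2 1 0 = W 1 2 0 + W 2 2 0 := by
    simp [hW, hexLocalStiffness, hexLocalMass, hexEdgeGram]
  have e2 : W 0 2 1 + W 1 1 0 = W 0 1 2 + W 1 0 1 := by
    simp [hW, hexLocalStiffness, hexLocalMass, hexEdgeGram]
  have hβ : W 1 2 0 + W 2 2 0 < 0 := by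
    have h1 : W 1 2 0 = -(1 / (4 * |hexDoubleArea d 1|) + lam * (|hexDoubleArea d 1| / 24)) := by
      simp [hW, hexLocalStiffness, hexLocalMass, hexEdgeGram]
      field_simp
      ring
    have h2 : W 2 2 0 =
        -(d ^ 2 / (4 * |hexDoubleArea d 2|) + lam * (|hexDoubleArea d 2| / 24)) := by
      simp [hW, hexLocalStiffness, hexLocalMass, hexEdgeGram]
      field_simp
      ring
    rw [h1, h2, ← neg_add, neg_lt_zero]
    positivity
  have hγ : W 0 1 0 + W 0 2 0 < 0 := by
    have h1 : W 0 1 0 + W 0 2 0 =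
        -(1 / (2 * |hexDoubleArea d 0|) + lam * (|hexDoubleArea d 0| / 12)) := by
      simp [hW, hexLocalStiffness, hexLocalMass, hexEdgeGram]
      field_simp
      ring
    rw [h1, neg_lt_zero]
    positivity
  -- The boundary rows force the values on the inner ring to alternate.
  have halt : ∀ k : Fin 6, v k.succ = -v (k - 1).succ := fun k => by
    have h := hB k
    rw [e1, ← mul_add] at h
    linarith [(mul_eq_zero.mp h).resolve_left hβ.ne]
  have h2 : v 2 = -v 1 := halt 1
  have h3 : v 3 = -v 2 := halt 2
  have h4 : v 4 = -v 3 := halt 3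
  have h5 : v 5 = -v 4 := halt 4
  have h6 : v 6 = -v 5 := halt 5
  -- Adding two neighbouring rows of the inner ring leaves only the value at the centre.
  have hR1 : (W 0 1 0 + W 0 2 0) * v 0 +
      (W 0 1 1 + W 0 2 2 + W 1 0 0 + W 1 1 1 + W 2 0 0) * v 1 +
      (W 0 1 2 + W 1 0 1) * v 2 + (W 0 2 1 + W 1 1 0) * v 6 = 0 := hR 0
  have hR2 : (W 0 1 0 + W 0 2 0) * v 0 +
      (W 0 1 1 + W 0 2 2 + W 1 0 0 + W 1 1 1 + W 2 0 0) * v 2 +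
      (W 0 1 2 + W 1 0 1) * v 3 + (W 0 2 1 + W 1 1 0) * v 1 = 0 := hR 1
  rw [h6, h5, h4, h3, h2, e2] at hR1
  rw [h3, h2, e2] at hR2
  have hv00 : v 0 = 0 := by
    have : (W 0 1 0 + W 0 2 0) * v 0 = 0 := by linarith
    exact (mul_eq_zero.mp this).resolve_left hγ.ne
  have hvc : v = v 1 • innerVector := by
    ext i
    fin_cases i <;> simp [innerVector, *]
  have hc : v 1 ≠ 0 := fun h => hv0 (by rw [hvc, h, zero_smul])
  refine ⟨?_, v 1, hc, hvc⟩
  have hz : (W 0 1 1 + W 0 2 2 + W 1 0 0 + W 1 1 1 + W 2 0 0) - 2 * (W 0 1 2 + W 1 0 1) = 0 := by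
    have : ((W 0 1 1 + W 0 2 2 + W 1 0 0 + W 1 1 1 + W 2 0 0) - 2 * (W 0 1 2 + W 1 0 1)) * v 1
        = 0 := by
      rw [hv00] at hR1
      linarith
    exact (mul_eq_zero.mp this).resolve_right hc
  rw [lambdaStar, hexStiffness_hexPosition hd, hexMass_hexPosition hd,
    assemble_hexTriangle_apply_ring, assemble_hexTriangle_apply_ring_next,
    assemble_hexTriangle_apply_ring, assemble_hexTriangle_apply_ring_next, eq_div_iff]
  · simp only [hW, Matrix.sub_apply, Matrix.smul_apply, smul_eq_mul] at hz
    linarith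
  · refine (?_ : (0:ℝ) < _).ne'
    simp [hexLocalMass]
    linarith

/-- Testing the boundary rows of a rotationally invariant matrix with the alternating vector
gives zero, as each inner node has two boundary neighbours with equal entries. -/
theorem assemble_toBlocks₂₁_mulVec_dotProduct_boundaryVector
    (W : Fin 3 → Matrix (Fin 3) (Fin 3) ℝ) (hW : W 1 2 1 + W 2 1 0 = W 1 2 0 + W 2 2 0)
    (v : Fin 7 → ℝ) :
    ((assemble hexTriangle fun t => W t.1).toBlocks₂₁ *ᵥ v) ⬝ᵥ boundaryVector = 0 := by
  have h : ∀ k : Fin 6, ((assemble hexTriangle fun t => W t.1).toBlocks₂₁ *ᵥ v) k =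
      (W 1 2 0 + W 2 2 0) * (v (k - 1).succ + v k.succ) := by
    intro k
    have := assemble_hexTriangle_mulVec_inr W v k
    rw [hW, ← mul_add] at this
    rw [← this]
    simp [Matrix.mulVec, dotProduct, Matrix.toBlocks₂₁]
  have h0 : v (0 - 1 : Fin 6).succ = v 6 := rfl
  have h1 : v (1 - 1 : Fin 6).succ = v 1 := rfl
  have h2 : v (2 - 1 : Fin 6).succ = v 2 := rfl
  have h3 : v (3 - 1 : Fin 6).succ = v 3 := rfl
  have h4 : v (4 - 1 : Fin 6).succ = v 4 := rfl
  have h5 : v (5 - 1 : Fin 6).succ = v 5 := rfl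
  simp only [dotProduct, Fin.sum_univ_six, h, h0, h1, h2, h3, h4, h5]
  simp [boundaryVector]
  ring

/-! ### Perturbation of the inner solutions -/

section Perturbation

variable {I B : Type} [Fintype I] [Fintype B]

theorem continuousAt_pencil_mulVec {m n : Type} [Fintype n] {F G : ℝ → Matrix m n ℝ} {s : ℝ}
    (hF : ∀ i j, ContinuousAt (fun s => F s i j) s) (hG : ∀ i j, ContinuousAt (fun s => G s i j) s)
    (q : (ℝ × ℝ) × (n → ℝ)) (i : m) :
    ContinuousAt (fun z : ℝ × ((ℝ × ℝ) × (n → ℝ)) =>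
      ((z.2.1.1 • F z.1 - z.2.1.2 • G z.1) *ᵥ z.2.2) i) (s, q) := by
  simp only [Matrix.mulVec, dotProduct, Matrix.sub_apply, Matrix.smul_apply, smul_eq_mul]
  refine tendsto_finsetSum _ fun j _ => ?_
  have h1 : ContinuousAt (fun z : ℝ × ((ℝ × ℝ) × (n → ℝ)) => F z.1 i j) (s, q) :=
    ContinuousAt.comp (g := fun s => F s i j) (hF i j) continuousAt_fst
  have h2 : ContinuousAt (fun z : ℝ × ((ℝ × ℝ) × (n → ℝ)) => G z.1 i j) (s, q) :=
    ContinuousAt.comp (g := fun s => G s i j) (hG i j) continuousAt_fst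
  have h3 : ContinuousAt (fun z : ℝ × ((ℝ × ℝ) × (n → ℝ)) => z.2.1.1) (s, q) := by fun_prop
  have h4 : ContinuousAt (fun z : ℝ × ((ℝ × ℝ) × (n → ℝ)) => z.2.1.2) (s, q) := by fun_prop
  have h5 : ContinuousAt (fun z : ℝ × ((ℝ × ℝ) × (n → ℝ)) => z.2.2 j) (s, q) := by fun_prop
  exact ((h3.mul h1).sub (h4.mul h2)).mul h5

/-- The entrywise difference quotient at `0` of a family of matrices, extended by the derivative. -/
noncomputable def matrixSlope {m n : Type} (F : ℝ → Matrix m n ℝ) (s : ℝ) : Matrix m n ℝ :=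
  Matrix.of fun i j => dslope (fun s => F s i j) 0 s

theorem matrixSlope_zero {m n : Type} (F : ℝ → Matrix m n ℝ) : matrixSlope F 0 = derivAtZero F := by
  ext i j
  simp [matrixSlope, derivAtZero]

theorem matrixSlope_of_ne {m n : Type} (F : ℝ → Matrix m n ℝ) {s : ℝ} (hs : s ≠ 0) :
    matrixSlope F s = s⁻¹ • (F s - F 0) := by
  ext i j
  simp [matrixSlope, dslope_of_ne _ hs, slope]

theorem continuousAt_matrixSlope {m n : Type} {F : ℝ → Matrix m n ℝ} {i : m} {j : n}
    (hF : DifferentiableAt ℝ (fun s => F s i j) 0) :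
    ContinuousAt (fun s => matrixSlope F s i j) 0 := by
  simpa [matrixSlope] using continuousAt_dslope_same.mpr hF

/-- Let the only inner solutions at `s = 0` be the multiples of `u` at the eigenvalue `lam₀`, and let
`w` annihilate the blocks `BI` at `s = 0`. If the derivative of the boundary equations for `u`,
tested with `w`, is not zero, then there are no inner solutions for small `s ≠ 0`. The pencil is
homogenized as `μ A - ν M`, so that the eigenvalues need no a priori bound. -/
theorem eventually_innerSolutions_eq_bot {A M : ℝ → Matrix (I ⊕ B) (I ⊕ B) ℝ}
    (hA : ∀ i j, DifferentiableAt ℝ (fun s => A s i j) 0)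
    (hM : ∀ i j, DifferentiableAt ℝ (fun s => M s i j) 0)
    (hM0 : ∀ v : I → ℝ, M 0 *ᵥ Sum.elim v 0 = 0 → v = 0)
    {lam₀ : ℝ} {u : I → ℝ}
    (huniq : ∀ lam v, v ∈ innerSolutions (A 0) (M 0) lam → v ≠ 0 →
      lam = lam₀ ∧ ∃ c : ℝ, c ≠ 0 ∧ v = c • u)
    {w : B → ℝ} (hwA : ∀ v, ((A 0).toBlocks₂₁ *ᵥ v) ⬝ᵥ w = 0)
    (hwM : ∀ v, ((M 0).toBlocks₂₁ *ᵥ v) ⬝ᵥ w = 0)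
    (hbreak : (((derivAtZero A).toBlocks₂₁ - lam₀ • (derivAtZero M).toBlocks₂₁) *ᵥ u) ⬝ᵥ w ≠ 0) :
    ∀ᶠ s in 𝓝[≠] 0, ∀ lam, innerSolutions (A s) (M s) lam = ⊥ := by
  let A' : ℝ → Matrix (I ⊕ B) I ℝ := fun s => (A s).submatrix id Sum.inl
  let M' : ℝ → Matrix (I ⊕ B) I ℝ := fun s => (M s).submatrix id Sum.inl
  have hsub : ∀ (K : Matrix (I ⊕ B) (I ⊕ B) ℝ) (v : I → ℝ),
      K *ᵥ Sum.elim v 0 = K.submatrix id Sum.inl *ᵥ v := by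
    intro K v
    ext i
    simp [Matrix.mulVec, dotProduct]
  let N : Set ((ℝ × ℝ) × (I → ℝ)) := Metric.sphere 0 1 ×ˢ Metric.sphere 0 1
  have hN : IsCompact N := (isCompact_sphere _ _).prod (isCompact_sphere _ _)
  have key : ∀ᶠ s in 𝓝 (0 : ℝ), ∀ q ∈ N, s ≠ 0 → (q.1.1 • A' s - q.1.2 • M' s) *ᵥ q.2 ≠ 0 := by
    refine hN.eventually_forall_of_forall_eventually fun q hq => ?_
    by_cases h : (q.1.1 • A' 0 - q.1.2 • M' 0) *ᵥ q.2 = 0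
    · -- The limit is an inner solution: the difference quotient of the boundary equations, tested
      -- with `w`, has a nonzero limit, but it vanishes for solutions at `s ≠ 0`.
      have hq2 : q.2 ≠ 0 := by
        intro h0
        have := hq.2
        simp [h0] at this
      have hμ : q.1.1 ≠ 0 := by
        intro h0
        have hν : q.1.2 ≠ 0 := by
          intro h1
          have := hq.1
          have h2 : q.1 = 0 := Prod.ext h0 h1
          simp [h2] at this
        rw [h0, zero_smul, zero_sub, Matrix.neg_mulVec, neg_eq_zero, Matrix.smul_mulVec,
          smul_eq_zero] at h
        exact hq2 (hM0 _ (by rw [hsub]; exact h.resolve_left hν))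
      have hmem : q.2 ∈ innerSolutions (A 0) (M 0) (q.1.2 / q.1.1) := by
        rw [mem_innerSolutions_iff, hsub]
        have h2 : (A 0 - (q.1.2 / q.1.1) • M 0).submatrix id Sum.inl =
            q.1.1⁻¹ • (q.1.1 • A' 0 - q.1.2 • M' 0) := by
          ext i j
          simp [A', M']
          field_simp
        rw [h2, Matrix.smul_mulVec, h, smul_zero]
      obtain ⟨hl, c, hc, hu⟩ := huniq _ _ hmem hq2
      let φ : ℝ × ((ℝ × ℝ) × (I → ℝ)) → ℝ := fun z =>
        ((z.2.1.1 • matrixSlope (fun s => (A s).toBlocks₂₁) z.1 -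
          z.2.1.2 • matrixSlope (fun s => (M s).toBlocks₂₁) z.1) *ᵥ z.2.2) ⬝ᵥ w
      have hφ : ContinuousAt φ (0, q) := by
        refine tendsto_finsetSum _ fun b _ => ?_
        exact (continuousAt_pencil_mulVec
          (fun b i => continuousAt_matrixSlope (F := fun s => (A s).toBlocks₂₁)
            (hA (Sum.inr b) (Sum.inl i)))
          (fun b i => continuousAt_matrixSlope (F := fun s => (M s).toBlocks₂₁)
            (hM (Sum.inr b) (Sum.inl i))) q b).mul continuousAt_const
      have hφ0 : φ (0, q) ≠ 0 := by
        have h1 : φ (0, q) = q.1.1 * c *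
            ((((derivAtZero A).toBlocks₂₁ - lam₀ • (derivAtZero M).toBlocks₂₁) *ᵥ u) ⬝ᵥ w) := by
          have h2 : q.1.2 = q.1.1 * lam₀ := by rw [← hl]; field_simp
          simp only [φ, matrixSlope_zero]
          rw [hu, h2, mul_smul, ← smul_sub, Matrix.smul_mulVec, Matrix.mulVec_smul,
            smul_dotProduct, smul_dotProduct, smul_eq_mul, smul_eq_mul, mul_assoc]
          rfl
        rw [h1]
        exact mul_ne_zero (mul_ne_zero hμ hc) hbreak
      filter_upwards [hφ.eventually_ne hφ0] with z hz hs h0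
      apply hz
      have hr : (z.2.1.1 • (A z.1).toBlocks₂₁ - z.2.1.2 • (M z.1).toBlocks₂₁) *ᵥ z.2.2 = 0 := by
        ext b
        exact congrFun h0 (Sum.inr b)
      have h2 : z.2.1.1 • matrixSlope (fun s => (A s).toBlocks₂₁) z.1 -
          z.2.1.2 • matrixSlope (fun s => (M s).toBlocks₂₁) z.1 =
          z.1⁻¹ • ((z.2.1.1 • (A z.1).toBlocks₂₁ - z.2.1.2 • (M z.1).toBlocks₂₁) -
            z.2.1.1 • (A 0).toBlocks₂₁ + z.2.1.2 • (M 0).toBlocks₂₁) := by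
        rw [matrixSlope_of_ne _ hs, matrixSlope_of_ne _ hs]
        module
      simp only [φ]
      rw [h2, Matrix.smul_mulVec, Matrix.add_mulVec, Matrix.sub_mulVec, hr, Matrix.smul_mulVec,
        Matrix.smul_mulVec, smul_dotProduct, add_dotProduct, sub_dotProduct, smul_dotProduct,
        smul_dotProduct, hwA, hwM]
      simp
    · -- The limit violates an equation, hence so do all nearby pairs and vectors.
      obtain ⟨i, hi⟩ := Function.ne_iff.mp h
      have hcont := continuousAt_pencil_mulVec (F := A') (G := M') (s := 0)
        (fun i j => (hA i (Sum.inl j)).continuousAt) (fun i j => (hM i (Sum.inl j)).continuousAt)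
        q i
      filter_upwards [hcont.eventually_ne hi] with z hz _ h0
      exact hz (congrFun h0 i)
  filter_upwards [nhdsWithin_le_nhds key, self_mem_nhdsWithin] with s hs hs0 lam
  rw [Submodule.eq_bot_iff]
  intro v hv
  by_contra hv0
  rw [mem_innerSolutions_iff, hsub] at hv
  have hpos : ((1 : ℝ), lam) ≠ 0 := fun h => one_ne_zero (congrArg Prod.fst h)
  refine hs (‖((1 : ℝ), lam)‖⁻¹ • ((1 : ℝ), lam), ‖v‖⁻¹ • v) ⟨?_, ?_⟩ hs0 ?_
  · simpa using norm_smul_inv_norm (𝕜 := ℝ) hpos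
  · simpa using norm_smul_inv_norm (𝕜 := ℝ) hv0
  · have h2 : (‖((1 : ℝ), lam)‖⁻¹ • ((1 : ℝ), lam)).1 • A' s -
        (‖((1 : ℝ), lam)‖⁻¹ • ((1 : ℝ), lam)).2 • M' s =
        ‖((1 : ℝ), lam)‖⁻¹ • (A s - lam • M s).submatrix id Sum.inl := by
      ext i j
      simp only [A', M', Prod.smul_fst, Prod.smul_snd, Matrix.sub_apply, Matrix.smul_apply,
        Matrix.submatrix_apply, smul_eq_mul]
      ring
    simp only [h2]
    rw [Matrix.smul_mulVec, Matrix.mulVec_smul, hv, smul_zero, smul_zero]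

end Perturbation

/-! ### Differentiability of the assembled matrices -/

theorem differentiableAt_assemble_apply {V τ : Type} [DecidableEq V] [Fintype τ]
    (tri : τ → Fin 3 → V) {W : ℝ → τ → Matrix (Fin 3) (Fin 3) ℝ} {s : ℝ}
    (hW : ∀ t b a, DifferentiableAt ℝ (fun s => W s t b a) s) (i j : V) :
    DifferentiableAt ℝ (fun s => assemble tri (W s) i j) s := by
  simp only [assemble, Matrix.of_apply]
  refine DifferentiableAt.fun_sum fun t _ => DifferentiableAt.fun_sum fun b _ =>
    DifferentiableAt.fun_sum fun a _ => ?_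
  split_ifs
  · exact hW t b a
  · exact differentiableAt_const _
  · exact differentiableAt_const _

theorem differentiableAt_doubleArea {p : ℝ → Fin 3 → Plane} {s : ℝ}
    (hp : ∀ a, DifferentiableAt ℝ (fun s => p s a) s) :
    DifferentiableAt ℝ (fun s => doubleArea (p s)) s := by
  have h : ∀ a i, DifferentiableAt ℝ (fun s => p s a i) s := fun a =>
    differentiableAt_euclidean.mp (hp a)
  unfold doubleArea
  exact (((h 1 0).sub (h 0 0)).mul ((h 2 1).sub (h 0 1))).sub
    (((h 2 0).sub (h 0 0)).mul ((h 1 1).sub (h 0 1)))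

theorem differentiableAt_localStiffness_apply {p : ℝ → Fin 3 → Plane} {s : ℝ}
    (hp : ∀ a, DifferentiableAt ℝ (fun s => p s a) s) (h0 : doubleArea (p s) ≠ 0) (b a : Fin 3) :
    DifferentiableAt ℝ (fun s => localStiffness (p s) b a) s := by
  simp only [localStiffness, Matrix.of_apply]
  exact (((hp _).sub (hp _)).inner ℝ ((hp _).sub (hp _))).div
    (((differentiableAt_doubleArea hp).abs h0).const_mul 2)
    (mul_ne_zero two_ne_zero (abs_ne_zero.mpr h0))

theorem differentiableAt_localMass_apply {p : ℝ → Fin 3 → Plane} {s : ℝ}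
    (hp : ∀ a, DifferentiableAt ℝ (fun s => p s a) s) (h0 : doubleArea (p s) ≠ 0) (b a : Fin 3) :
    DifferentiableAt ℝ (fun s => localMass (p s) b a) s := by
  simp only [localMass, Matrix.of_apply]
  exact ((differentiableAt_doubleArea hp).abs h0).mul_const _

end P1FEM

open P1FEM
theorem theorem4p3 (d : ℝ) (hd : 2 / Real.sqrt 3 < d)
    (hsimple : IsSimpleNeumannEigenvalue (hexStiffness (hexPosition d)) (hexMass (hexPosition d))
      (lambdaStar d))
    (x : HexNode → ℝ → Plane) (hx : ∀ v, ContDiffAt ℝ 1 (x v) 0)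
    (hx0 : ∀ v, x v 0 = hexPosition d v)
    (hbreak :
      (((derivAtZero fun s => hexStiffness fun v => x v s).toBlocks₂₁ -
          lambdaStar d • (derivAtZero fun s => hexMass fun v => x v s).toBlocks₂₁) *ᵥ
        innerVector) ⬝ᵥ boundaryVector ≠ 0) :
    ∃ ε > 0, ∀ s : ℝ, 0 < |s| → |s| < ε →
      UniqueContinuation hexTriangle fun v => x v s := by
  have hxd : ∀ t a, DifferentiableAt ℝ (fun s => x (hexTriangle t a) s) 0 := fun t a =>
    (hx _).differentiableAt one_ne_zero
  have hx0' : (fun v => x v 0) = hexPosition d := funext hx0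
  have hD0 : ∀ t, doubleArea (fun a => x (hexTriangle t a) 0) ≠ 0 := by
    intro t
    simp only [hx0]
    exact doubleArea_hexPosition_ne_zero hd t
  have hD : ∀ᶠ s in nhds (0 : ℝ), ∀ t, doubleArea (fun a => x (hexTriangle t a) s) ≠ 0 :=
    Filter.eventually_all.mpr fun t =>
      (differentiableAt_doubleArea (hxd t)).continuousAt.eventually_ne (hD0 t)
  have hA : ∀ i j, DifferentiableAt ℝ (fun s => hexStiffness (fun v => x v s) i j) 0 := by
    intro i j
    refine (differentiableAt_assemble_apply hexTriangle (fun t b a =>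
      differentiableAt_localStiffness_apply (hxd t) (hD0 t) b a) i j).congr_of_eventuallyEq ?_
    filter_upwards [hD] with s hs
    rw [hexStiffness_eq_assemble _ hs]
  have hM : ∀ i j, DifferentiableAt ℝ (fun s => hexMass (fun v => x v s) i j) 0 := by
    intro i j
    refine (differentiableAt_assemble_apply hexTriangle (fun t b a =>
      differentiableAt_localMass_apply (hxd t) (hD0 t) b a) i j).congr_of_eventuallyEq ?_
    filter_upwards [hD] with s hs
    rw [hexMass_eq_assemble _ hs]
  have hev := eventually_innerSolutions_eq_bot hA hM
    (by
      rw [hx0']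
      exact hexMass_mulVec_eq_zero hd)
    (by
      rw [hx0']
      exact fun lam v => eq_smul_innerVector_of_mem_innerSolutions hd)
    (by
      rw [hx0', hexStiffness_hexPosition hd]
      exact assemble_toBlocks₂₁_mulVec_dotProduct_boundaryVector _
        (by simp [hexLocalStiffness, hexEdgeGram]))
    (by
      rw [hx0', hexMass_hexPosition hd]
      exact assemble_toBlocks₂₁_mulVec_dotProduct_boundaryVector _ (by simp [hexLocalMass]))
    hbreak
  obtain ⟨ε, hε, h⟩ := Metric.eventually_nhds_iff.mp (eventually_nhdsWithin_iff.mp hev)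
  exact ⟨ε, hε, fun s hs0 hs => h (by simpa using hs) (by simpa using hs0)⟩
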